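/- **Setting.** Fix $\boldsymbol X\in\mathbb R^{n\times p}$ ($p\ge1$) with spectral norm $\|\boldsymbol X\|_2$, a parameter $\varrho\ge\|\boldsymbol X\|_2$, a vector $\boldsymbol\beta^*\in\mathbb R^p$, and $\sigma\ge 0$. For $\psi:\mathbb R^d\to\mathbb R$ let $\delta\psi(\boldsymbol\beta;\boldsymbol h)=\lim_{\epsilon\to0+}\{\psi(\boldsymbol\beta+\epsilon\boldsymbol h)-\psi(\boldsymbol\beta)\}/\epsilon$; $\psi$ is directionally differentiable if this limit exists and is finite for all $\boldsymbol\beta,\boldsymbol h$. Put $$\boldsymbol\Delta_\psi(\boldsymbol\beta,\boldsymbol\gamma)=\psi(\boldsymbol\beta)-\psi(\boldsymbol\gamma)-\delta\psi(\boldsymbol\gamma;\boldsymbol\beta-\boldsymbol\gamma),\quad \bar{\boldsymbol\Delta}_\psi(\boldsymbol\beta,\boldsymbol\gamma)=\tfrac12\{\boldsymbol\Delta_\psi(\boldsymbol\beta,\boldsymbol\gamma)+\boldsymbol\Delta_\psi(\boldsymbol\gamma,\boldsymbol\beta)\},\quad \mathbf D_2(\boldsymbol\beta,\boldsymbol\gamma)=\tfrac12\|\boldsymbol\beta-\boldsymbol\gamma\|_2^2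 .$$ A thresholding is a function $\Theta(t;\lambda)$, $t\in\mathbb R$, $\lambda\ge0$, that is odd and nondecreasing in $t$, tends to $\infty$ as $t\to\infty$, and satisfies $0\le\Theta(t;\lambda)\le t$ for $t\ge0$. Put $\Theta^{-1}(u;\lambda)=\sup\{t:\Theta(t;\lambda)\le u\}$, $\mathcal L_\Theta=1-\operatorname{ess\,inf}_{u\ge0}\mathrm d\Theta^{-1}(u;\lambda)/\mathrm du$, $P_\Theta(t;\lambda)=\int_0^{|t|}(\Theta^{-1}(u;\lambda)-u)\,\mathrm du$ and $P_H(t;\lambda)=(-t^2/2+\lambda|t|)1_{|t|<\lambda}+(\lambda^2/2)1_{|t|\ge\lambda}$; penalties of vectors are sums over coordinates. Let $J(\boldsymbol\beta)$ be the number of nonzero entries of $\boldsymbol\beta$, and $J^*=J(\boldsymbol\beta^*)$. Let $l_0:\mathbb R^n\to\mathbb R$ be a random loss and $l(\boldsymbol\beta)=l_0(\boldsymbol X\boldsymbol\beta)$. Assume that almost surely $l$ is directionally differentiable and $l_0$ is differentiable at $\boldsymbol X\boldsymbol\beta^*$, and that the effective noise $\boldsymbol\epsilon=-\nabla l_0(\boldsymbol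 X\boldsymbol\beta^*)$ is a sub-Gaussian random vector with mean $\boldsymbol 0$ and scale bounded by $\sigma$: each $\langle\boldsymbol\epsilon,\boldsymbol\alpha\rangle$ is sub-Gaussian with $\|\langle\boldsymbol\epsilon,\boldsymbol\alpha\rangle\|_{\psi_2}\le\sigma\|\boldsymbol\alpha\|_2$, where $\|\xi\|_{\psi_2}=\inf\{s>0:\mathbb E\exp(\xi^2/s^2)\le2\}$. For a directionally differentiable $\psi:\mathbb R^p\to\mathbb R$ let $$g_\psi(\boldsymbol\beta;\boldsymbol\beta^-)=l(\boldsymbol\beta)+P_\Theta(\varrho\boldsymbol\beta;\lambda)+\boldsymbol\Delta_\psi(\boldsymbol\beta,\boldsymbol\beta^-).$$ **Theorem.** There are universal constants $A_0,C,c>0$ such that the following holds for every $A\ge A_0$. Let $\delta,\vartheta>0$, $K\ge0$ and $\lambda=A\sigma\sqrt{\log(ep)}/\sqrt{(\delta\wedge\vartheta)\vartheta}$, and suppose that almost surely, for every $\boldsymbol\beta\in\mathbb R^p$, $$\varrho^2\mathcal L_\Theta\mathbf D_2(\boldsymbol\beta,\boldsymbol\beta^*)+\delta\mathbf D_2(\boldsymbol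 X\boldsymbol\beta,\boldsymbol X\boldsymbol\beta^*)+\vartheta P_H(\varrho(\boldsymbol\beta-\boldsymbol\beta^*);\lambda)+P_\Theta(\varrho\boldsymbol\beta^*;\lambda)\le 2\bar{\boldsymbol\Delta}_l(\boldsymbol\beta,\boldsymbol\beta^*)+P_\Theta(\varrho\boldsymbol\beta;\lambda)+K\lambda^2J^* .$$ Then there is an event of probability at least $1-Cp^{-cA^2}$ on which, for every directionally differentiable $\psi$ and every fixed point $\hat{\boldsymbol\beta}\in\arg\min_{\boldsymbol\beta}g_\psi(\boldsymbol\beta;\hat{\boldsymbol\beta})$, $$\mathbf D_2(\boldsymbol X\hat{\boldsymbol\beta},\boldsymbol X\boldsymbol\beta^*)\le\frac{2KA^2}{(\delta\wedge\vartheta)\delta\vartheta}\,\sigma^2J^*\log(ep),\qquad P_H(\varrho(\hat{\boldsymbol\beta}-\boldsymbol\beta^*);\lambda)\le\frac{4KA^2}{(\delta\wedge\vartheta)\vartheta^2}\,\sigma^2J^*\log(ep).$$ -/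

import Mathlib

open MeasureTheory Filter Topology

noncomputable section

namespace Breg

/-- `ℝ^d` with the Euclidean norm. -/
abbrev Vec (d : ℕ) := EuclideanSpace ℝ (Fin d)

/-! ### One-sided directional derivatives and generalized Bregman functions -/

/-- `v` is the one-sided directional derivative of `ψ` at `β` with increment `h`. -/
def HasDirDeriv {d : ℕ} (ψ : Vec d → ℝ) (β h : Vec d) (v : ℝ) : Prop :=
  Tendsto (fun ε : ℝ => (ψ (β + ε • h) - ψ β) / ε) (𝓝[>] 0) (𝓝 v)

/-- `ψ` is directionally differentiable: every one-sided directional derivative exists and is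
finite. -/
def DirDifferentiable {d : ℕ} (ψ : Vec d → ℝ) : Prop :=
  ∀ β h : Vec d, ∃ v : ℝ, HasDirDeriv ψ β h v

/-- The one-sided directional derivative `δψ(β; h)`. -/
def dirDeriv {d : ℕ} (ψ : Vec d → ℝ) (β h : Vec d) : ℝ :=
  limUnder (𝓝[>] (0 : ℝ)) (fun ε : ℝ => (ψ (β + ε • h) - ψ β) / ε)

/-- The generalized Bregman function `Δ_ψ(β, γ) = ψ(β) - ψ(γ) - δψ(γ; β - γ)`. -/
def gbf {d : ℕ} (ψ : Vec d → ℝ) (β γ : Vec d) : ℝ :=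
  ψ β - ψ γ - dirDeriv ψ γ (β - γ)

/-- The symmetrized generalized Bregman function. -/
def symGbf {d : ℕ} (ψ : Vec d → ℝ) (β γ : Vec d) : ℝ :=
  (gbf ψ β γ + gbf ψ γ β) / 2

/-- `D₂(β, γ) = ‖β - γ‖₂² / 2`. -/
def D2 {d : ℕ} (β γ : Vec d) : ℝ := ‖β - γ‖ ^ 2 / 2

/-! ### Thresholding functions and the penalties they induce -/

/-- A thresholding function `Θ(t; λ)`, `t ∈ ℝ`, `0 ≤ λ < ∞`; written `Θ t lam`. Values at negative
`lam` are irrelevant. -/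
structure IsThresholding (Θ : ℝ → ℝ → ℝ) : Prop where
  odd : ∀ lam, 0 ≤ lam → ∀ t, Θ (-t) lam = -Θ t lam
  mono : ∀ lam, 0 ≤ lam → ∀ t t', t ≤ t' → Θ t lam ≤ Θ t' lam
  tendsto : ∀ lam, 0 ≤ lam → Tendsto (fun t => Θ t lam) atTop atTop
  nonneg : ∀ lam, 0 ≤ lam → ∀ t, 0 ≤ t → 0 ≤ Θ t lam
  le_self : ∀ lam, 0 ≤ lam → ∀ t, 0 ≤ t → Θ t lam ≤ t

/-- `Θ⁻¹(u; λ) = sup {t : Θ(t; λ) ≤ u}`. -/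
def thetaInv (Θ : ℝ → ℝ → ℝ) (lam u : ℝ) : ℝ := sSup {t : ℝ | Θ t lam ≤ u}

/-- The concavity number `L_Θ = 1 - ess inf {dΘ⁻¹(u; λ)/du : u ≥ 0}`. The function `Θ⁻¹` is
nondecreasing, hence differentiable almost everywhere. -/
def concavityNumber (Θ : ℝ → ℝ → ℝ) (lam : ℝ) : ℝ :=
  1 - essInf (fun u : ℝ => deriv (thetaInv Θ lam) u) (volume.restrict (Set.Ici (0 : ℝ)))

/-- The univariate penalty `P_Θ(t; λ) = ∫_0^{|t|} (Θ⁻¹(u; λ) - u) du`. -/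
def penTheta₁ (Θ : ℝ → ℝ → ℝ) (t lam : ℝ) : ℝ :=
  ∫ u in (0 : ℝ)..|t|, (thetaInv Θ lam u - u)

/-- `P_Θ(β; λ) = ∑ⱼ P_Θ(βⱼ; λ)`. -/
def penTheta {p : ℕ} (Θ : ℝ → ℝ → ℝ) (β : Vec p) (lam : ℝ) : ℝ :=
  ∑ j, penTheta₁ Θ (β j) lam

/-- The univariate hard penalty
`P_H(t; λ) = (-t²/2 + λ|t|) 1_{|t| < λ} + (λ²/2) 1_{|t| ≥ λ}`. -/
def penHard₁ (t lam : ℝ) : ℝ :=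
  if |t| < lam then -t ^ 2 / 2 + lam * |t| else lam ^ 2 / 2

/-- `P_H(β; λ) = ∑ⱼ P_H(βⱼ; λ)`. -/
def penHard {p : ℕ} (β : Vec p) (lam : ℝ) : ℝ := ∑ j, penHard₁ (β j) lam

/-- `J(β)`, the number of nonzero entries of `β`. -/
def suppCard {p : ℕ} (β : Vec p) : ℕ := (Finset.univ.filter fun j => β j ≠ 0).card

/-! ### The composite problem and its F-estimators -/

/-- The linear map `β ↦ X β` between Euclidean spaces; its norm is the spectral norm of `X`. -/
def design {n p : ℕ} (X : Matrix (Fin n) (Fin p) ℝ) : Vec p →L[ℝ] Vec n :=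
  LinearMap.toContinuousLinearMap (Matrix.toEuclideanLin X)

/-- The loss `l(β) = l₀(X β)`. -/
def loss {n p : ℕ} (l₀ : Vec n → ℝ) (X : Matrix (Fin n) (Fin p) ℝ) : Vec p → ℝ :=
  fun β => l₀ (design X β)

/-- The Bregman surrogate `g(β; β⁻) = l(β) + P_Θ(ϱβ; λ) + Δ_ψ(β, β⁻)`. -/
def surrogate {n p : ℕ} (l₀ : Vec n → ℝ) (X : Matrix (Fin n) (Fin p) ℝ) (Θ : ℝ → ℝ → ℝ)
    (rho lam : ℝ) (ψ : Vec p → ℝ) (β βprev : Vec p) : ℝ :=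
  loss l₀ X β + penTheta Θ (rho • β) lam + gbf ψ β βprev

/-- `b` is a fixed point of the surrogate, `b ∈ argmin_β g(β; b)`. -/
def IsFEstimator {n p : ℕ} (l₀ : Vec n → ℝ) (X : Matrix (Fin n) (Fin p) ℝ) (Θ : ℝ → ℝ → ℝ)
    (rho lam : ℝ) (ψ : Vec p → ℝ) (b : Vec p) : Prop :=
  ∀ β : Vec p, surrogate l₀ X Θ rho lam ψ b b ≤ surrogate l₀ X Θ rho lam ψ β b

/-- The regularity condition at the truth `βs`, with constants `δ`, `ϑ`, `K`. -/
def RegularityCondition {n p : ℕ} (l₀ : Vec n → ℝ) (X : Matrix (Fin n) (Fin p) ℝ)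
    (Θ : ℝ → ℝ → ℝ) (rho lam : ℝ) (βs : Vec p) (δ ϑ K : ℝ) : Prop :=
  ∀ β : Vec p,
    rho ^ 2 * concavityNumber Θ lam * D2 β βs + δ * D2 (design X β) (design X βs)
        + ϑ * penHard (rho • (β - βs)) lam + penTheta Θ (rho • βs) lam
      ≤ 2 * symGbf (loss l₀ X) β βs + penTheta Θ (rho • β) lam
        + K * lam ^ 2 * (suppCard βs : ℝ)

/-! ### Sub-Gaussian noise -/

/-- `ξ` is sub-Gaussian: `P(|ξ| ≥ t) ≤ C exp(-c t²)` for all `t > 0`, for some `C, c > 0`. -/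
def IsSubGaussian {Ω : Type*} [MeasurableSpace Ω] (μ : Measure Ω) (ξ : Ω → ℝ) : Prop :=
  ∃ C > (0 : ℝ), ∃ c > (0 : ℝ), ∀ t > (0 : ℝ),
    μ {ω | t ≤ |ξ ω|} ≤ ENNReal.ofReal (C * Real.exp (-c * t ^ 2))

/-- The scale `inf {s > 0 : E exp(ξ²/s²) ≤ 2}` of `ξ` (the set is nonempty when `ξ` is
sub-Gaussian). -/
def psi2Norm {Ω : Type*} [MeasurableSpace Ω] (μ : Measure Ω) (ξ : Ω → ℝ) : ℝ :=
  sInf {s : ℝ | 0 < s ∧ ∫⁻ ω, ENNReal.ofReal (Real.exp (ξ ω ^ 2 / s ^ 2)) ∂μ ≤ 2}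

/-- `ξ` is a sub-Gaussian random vector with scale bounded by `σ`. -/
def IsSubGaussianVec {Ω : Type*} [MeasurableSpace Ω] {n : ℕ} (μ : Measure Ω) (ξ : Ω → Vec n)
    (σ : ℝ) : Prop :=
  AEMeasurable ξ μ ∧ ∀ α : Vec n,
    IsSubGaussian μ (fun ω => inner ℝ (ξ ω) α) ∧
      psi2Norm μ (fun ω => inner ℝ (ξ ω) α) ≤ σ * ‖α‖

/-- The effective noise `ε = -∇l₀(X β*)` of a random loss `l₀`. -/
def effectiveNoise {Ω : Type*} {n p : ℕ} (l₀ : Ω → Vec n → ℝ) (X : Matrix (Fin n) (Fin p) ℝ)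
    (βs : Vec p) : Ω → Vec n :=
  fun ω => -gradient (l₀ ω) (design X βs)

end Breg

end

open Breg

namespace Breg

/-! ### The penalty induced by a thresholding -/

section Penalty

variable {Θ : ℝ → ℝ → ℝ} {lam : ℝ}

/-! The fixed-point property is used only to first order. Since P_Θ(t) + L_Θ t²/2 is convex, moving
from a fixed point b towards β* costs at most ϱ² L_Θ D₂(b, β*) beyond the chord of the penalty,
while Δ_ψ(·, b) is o(ε) along each ray, so ψ disappears (`first_order`). Combined with the
regularity condition, the curvature term, the penalties and the derivative at b cancel, leaving δD₂
+ ϑP_H ≤ ⟨ε, X(b - β*)⟩ + Kλ²J* (`basic_inequality`).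

The noise term is then bounded deterministically, given that the squared projection of ε on the span
of the columns in J is at most R|J| for every nonempty J (`inner_design_le`). A coordinate with
ϱ|β_j| ≥ λ contributes λ²/2 to P_H, which pays for its share of the projection; smaller coordinates
are treated one column at a time, and ϱ ≥ ‖X‖ controls their effect on the prediction error. Half of
the left side absorbs the noise.

The uniform projection bound is `measure_exists_colSpan_gt_le`. The exponential of a squared norm is
a Gaussian average of exponentials of linear forms, which reduces the tail to scalar moment
generating functions; a union bound over J follows. The resulting event does not depend on ψ or b,
so it serves all of them at once. -/

theorem IsThresholding.bddAbove (hΘ : IsThresholding Θ) (hlam : 0 ≤ lam) (u : ℝ) :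
    BddAbove {t : ℝ | Θ t lam ≤ u} := by
  obtain ⟨T, hT⟩ := ((hΘ.tendsto lam hlam).eventually_gt_atTop u).exists
  refine ⟨T, fun t ht => ?_⟩
  by_contra! h
  exact absurd (hΘ.mono lam hlam _ _ h.le) (not_le.2 (lt_of_le_of_lt ht hT))

theorem IsThresholding.monotone_thetaInv (hΘ : IsThresholding Θ) (hlam : 0 ≤ lam) :
    Monotone (thetaInv Θ lam) := by
  intro u v huv
  refine csSup_le_csSup (hΘ.bddAbove hlam v) ?_ fun t ht => le_trans ht huv
  -- Nonemptiness of the sublevel set: by oddness, a large T with Θ(T) ≥ -u gives Θ(-T) ≤ u.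
  obtain ⟨T, hT⟩ := ((hΘ.tendsto lam hlam).eventually_ge_atTop (-u)).exists
  exact ⟨-T, by simp only [Set.mem_ofPred_eq, hΘ.odd lam hlam]; linarith⟩

theorem IsThresholding.thetaInv_nonneg (hΘ : IsThresholding Θ) (hlam : 0 ≤ lam) :
    0 ≤ thetaInv Θ lam 0 :=
  le_csSup (hΘ.bddAbove hlam 0) (hΘ.le_self lam hlam 0 le_rfl)

/-- The integral of the derivative of a monotone function is at most its increment, so jumps of Θ⁻¹
only help. Nonnegativity of that derivative supplies the lower bound needed to use the real-valued
`essInf`. -/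
theorem IsThresholding.concavityNumber_slope (hΘ : IsThresholding Θ) (hlam : 0 ≤ lam) {u v : ℝ}
    (hu : 0 ≤ u) (huv : u ≤ v) :
    (1 - concavityNumber Θ lam) * (v - u) ≤ thetaInv Θ lam v - thetaInv Θ lam u := by
  have hmono := hΘ.monotone_thetaInv hlam
  have hae : ∀ᵐ x ∂volume.restrict (Set.Ici (0 : ℝ)),
      1 - concavityNumber Θ lam ≤ deriv (thetaInv Θ lam) x := by
    rw [concavityNumber, sub_sub_cancel]
    exact ae_essInf_le ⟨0, eventually_map.2 (Eventually.of_forall fun x => hmono.deriv_nonneg)⟩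
  have hmon : MonotoneOn (thetaInv Θ lam) (Set.uIcc u v) := hmono.monotoneOn _
  have h1 : ∫ _ in u..v, (1 - concavityNumber Θ lam) ≤ ∫ x in u..v, deriv (thetaInv Θ lam) x := by
    refine intervalIntegral.integral_mono_ae_restrict huv (by simp) hmon.intervalIntegrable_deriv
      (ae_mono (Measure.restrict_mono (fun x hx => hu.trans hx.1) le_rfl) hae)
  have h2 := hmon.intervalIntegral_deriv_mem_uIcc
  rw [Set.uIcc_of_le (sub_nonneg.2 (hmono huv))] at h2
  rw [intervalIntegral.integral_const, smul_eq_mul] at h1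
  linarith [h2.2]

theorem IsThresholding.penTheta₁_add_sq (hΘ : IsThresholding Θ) (hlam : 0 ≤ lam) (t : ℝ) :
    penTheta₁ Θ t lam + concavityNumber Θ lam / 2 * t ^ 2 =
      ∫ u in (0 : ℝ)..|t|, (thetaInv Θ lam u - (1 - concavityNumber Θ lam) * u) := by
  have hint : IntervalIntegrable (thetaInv Θ lam) volume 0 |t| :=
    (hΘ.monotone_thetaInv hlam).intervalIntegrable
  rw [penTheta₁, intervalIntegral.integral_sub hint (by simp),
    intervalIntegral.integral_sub hint
      (Continuous.intervalIntegrable (by fun_prop : Continuous fun u : ℝ => _ * u) _ _),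
    intervalIntegral.integral_const_mul]
  simp only [integral_id, sq_abs]
  ring

/-- `P_Θ` plus the quadratic `L_Θ t² / 2` admits a supporting line at every point. -/
theorem IsThresholding.exists_subgradient (hΘ : IsThresholding Θ) (hlam : 0 ≤ lam) (z : ℝ) :
    ∃ g : ℝ, ∀ y : ℝ,
      penTheta₁ Θ z lam + concavityNumber Θ lam / 2 * z ^ 2 + g * (y - z) ≤
        penTheta₁ Θ y lam + concavityNumber Θ lam / 2 * y ^ 2 := by
  set s : ℝ → ℝ := fun u => thetaInv Θ lam u - (1 - concavityNumber Θ lam) * u with hs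
  have hmono : ∀ u v, 0 ≤ u → u ≤ v → s u ≤ s v := fun u v hu huv => by
    have := hΘ.concavityNumber_slope hlam hu huv
    simp only [hs]; linarith
  -- The sign of s is what keeps t ↦ ∫₀^{|t|} s convex across the kink at 0.
  have h0 : ∀ u, 0 ≤ u → 0 ≤ s u := fun u hu => by
    refine le_trans ?_ (hmono 0 u le_rfl hu)
    simpa [hs] using hΘ.thetaInv_nonneg hlam
  have hint : ∀ a b : ℝ, IntervalIntegrable s volume a b := fun a b =>
    (hΘ.monotone_thetaInv hlam).intervalIntegrable.sub
      (Continuous.intervalIntegrable (by fun_prop) _ _)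
  have key : ∀ x y : ℝ, 0 ≤ x → 0 ≤ y → s x * (y - x) ≤ ∫ u in x..y, s u := by
    intro x y hx hy
    rcases le_total x y with hxy | hxy
    · have := intervalIntegral.integral_mono_on hxy (by simp) (hint x y)
        fun u hu => hmono x u hx hu.1
      simpa [mul_comm] using this
    · have := intervalIntegral.integral_mono_on hxy (hint y x) (by simp)
        fun u hu => hmono u x (hy.trans hu.1) hu.2
      rw [intervalIntegral.integral_symm]
      simp only [intervalIntegral.integral_const, smul_eq_mul] at this
      linarith
  refine ⟨if 0 ≤ z then s |z| else -s |z|, fun y => ?_⟩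
  rw [hΘ.penTheta₁_add_sq hlam, hΘ.penTheta₁_add_sq hlam]
  have hk := key |z| |y| (abs_nonneg _) (abs_nonneg _)
  have hadd := intervalIntegral.integral_add_adjacent_intervals (hint 0 |z|) (hint |z| |y|)
  have hz := h0 |z| (abs_nonneg _)
  have : (if 0 ≤ z then s |z| else -s |z|) * (y - z) ≤ s |z| * (|y| - |z|) := by
    split_ifs with h
    · rw [abs_of_nonneg h] at hz ⊢
      exact mul_le_mul_of_nonneg_left (by linarith [le_abs_self y]) hz
    · rw [abs_of_neg (not_le.1 h)] at hz ⊢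
      nlinarith [neg_abs_le y]
  linarith

/-- Weight the supporting line at the intermediate point by 1 - e at x and by e at y: the slopes
cancel, and the quadratics leave e(1 - e)(y - x)². -/
theorem IsThresholding.penTheta₁_segment_le (hΘ : IsThresholding Θ) (hlam : 0 ≤ lam) (x y e : ℝ)
    (he0 : 0 ≤ e) (he1 : e ≤ 1) :
    penTheta₁ Θ (x + e * (y - x)) lam - penTheta₁ Θ x lam ≤
      e * (penTheta₁ Θ y lam - penTheta₁ Θ x lam) +
        concavityNumber Θ lam / 2 * (e * (1 - e) * (y - x) ^ 2) := by
  obtain ⟨g, hg⟩ := hΘ.exists_subgradient hlam (x + e * (y - x))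
  have hx := mul_le_mul_of_nonneg_left (hg x) (sub_nonneg.2 he1)
  have hy := mul_le_mul_of_nonneg_left (hg y) he0
  linear_combination hx + hy

theorem IsThresholding.penTheta_segment_le (hΘ : IsThresholding Θ) (hlam : 0 ≤ lam) {p : ℕ}
    (x y : Vec p) (rho e : ℝ) (he0 : 0 ≤ e) (he1 : e ≤ 1) :
    penTheta Θ (rho • (x + e • (y - x))) lam - penTheta Θ (rho • x) lam ≤
      e * (penTheta Θ (rho • y) lam - penTheta Θ (rho • x) lam) +
        e * (1 - e) * (rho ^ 2 * concavityNumber Θ lam * D2 x y) := by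
  have hD : D2 x y = (∑ j, (y j - x j) ^ 2) / 2 := by
    rw [D2, norm_sub_rev, EuclideanSpace.real_norm_sq_eq]
    simp
  rw [hD]
  simp only [penTheta, ← Finset.sum_sub_distrib]
  rw [Finset.mul_sum, Finset.sum_div, Finset.mul_sum, Finset.mul_sum, ← Finset.sum_add_distrib]
  refine Finset.sum_le_sum fun j _ => ?_
  have := hΘ.penTheta₁_segment_le hlam (rho * x j) (rho * y j) e he0 he1
  simp only [PiLp.smul_apply, PiLp.add_apply, PiLp.sub_apply, smul_eq_mul]
  rw [show rho * (x j + e * (y j - x j)) = rho * x j + e * (rho * y j - rho * x j) by ring]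
  linear_combination this

end Penalty

/-! ### Directional derivatives and fixed points of the surrogate -/

section DirDeriv

variable {d : ℕ} {ψ : Vec d → ℝ} {β h : Vec d} {v : ℝ}

theorem HasDirDeriv.dirDeriv_eq (hv : HasDirDeriv ψ β h v) : dirDeriv ψ β h = v :=
  Tendsto.limUnder_eq hv

theorem DirDifferentiable.hasDirDeriv (hψ : DirDifferentiable ψ) (β h : Vec d) :
    HasDirDeriv ψ β h (dirDeriv ψ β h) := by
  obtain ⟨v, hv⟩ := hψ β h
  rwa [hv.dirDeriv_eq]

theorem HasDirDeriv.smul (hv : HasDirDeriv ψ β h v) {c : ℝ} (hc : 0 < c) :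
    HasDirDeriv ψ β (c • h) (c * v) := by
  have hlim : Tendsto (fun ε : ℝ => ε * c) (𝓝[>] 0) (𝓝[>] 0) := by
    refine tendsto_nhdsWithin_iff.2 ⟨?_, ?_⟩
    · have : Tendsto (fun ε : ℝ => ε * c) (𝓝 0) (𝓝 (0 * c)) := tendsto_id.mul_const c
      rw [zero_mul] at this
      exact this.mono_left nhdsWithin_le_nhds
    · filter_upwards [self_mem_nhdsWithin] with ε hε using mul_pos hε hc
  refine ((hv.comp hlim).const_mul c).congr fun ε => ?_
  simp only [Function.comp_apply, smul_smul]
  rw [← mul_div_assoc, mul_comm ε c, mul_div_mul_left _ _ hc.ne']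

theorem hasDirDeriv_zero (ψ : Vec d → ℝ) (β : Vec d) : HasDirDeriv ψ β 0 0 := by
  simp [HasDirDeriv]

theorem gbf_self (ψ : Vec d → ℝ) (β : Vec d) : gbf ψ β β = 0 := by
  simp [gbf, (hasDirDeriv_zero ψ β).dirDeriv_eq]

/-- By positive homogeneity of the directional derivative, Δ_ψ(β + εh, β)/ε is a difference quotient
minus its own limit. This is why ψ leaves no trace in the optimality condition. -/
theorem DirDifferentiable.tendsto_gbf_div (hψ : DirDifferentiable ψ) (β h : Vec d) :
    Tendsto (fun ε : ℝ => gbf ψ (β + ε • h) β / ε) (𝓝[>] 0) (𝓝 0) := by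
  have := (hψ.hasDirDeriv β h).sub_const (dirDeriv ψ β h)
  rw [sub_self] at this
  refine this.congr' ?_
  filter_upwards [self_mem_nhdsWithin] with ε hε
  have hε' : (0 : ℝ) < ε := hε
  rw [gbf, add_sub_cancel_left, ((hψ.hasDirDeriv β h).smul hε').dirDeriv_eq]
  field_simp

end DirDeriv

theorem hasDirDeriv_loss {n p : ℕ} {l₀ : Vec n → ℝ} {X : Matrix (Fin n) (Fin p) ℝ} {β : Vec p}
    (hl₀ : DifferentiableAt ℝ l₀ (design X β)) (h : Vec p) :
    HasDirDeriv (loss l₀ X) β h (inner ℝ (gradient l₀ (design X β)) (design X h)) := by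
  have h1 := (hl₀.hasGradientAt.hasFDerivAt.hasLineDerivAt (design X h)).tendsto_slope_zero_right
  refine (h1.congr fun t => ?_).trans (by simp)
  simp [loss, map_add, map_smul, div_eq_inv_mul]

/-- First-order optimality of a fixed point of the surrogate, in the direction of `y`. -/
theorem IsFEstimator.first_order {n p : ℕ} {l₀ : Vec n → ℝ} {X : Matrix (Fin n) (Fin p) ℝ}
    {Θ : ℝ → ℝ → ℝ} {rho lam : ℝ} {ψ : Vec p → ℝ} {b : Vec p}
    (hb : IsFEstimator l₀ X Θ rho lam ψ b) (hΘ : IsThresholding Θ) (hlam : 0 ≤ lam)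
    (hψ : DirDifferentiable ψ) (hl : DirDifferentiable (loss l₀ X)) (y : Vec p) :
    0 ≤ dirDeriv (loss l₀ X) b (y - b) + (penTheta Θ (rho • y) lam - penTheta Θ (rho • b) lam) +
      rho ^ 2 * concavityNumber Θ lam * D2 b y := by
  set Q := rho ^ 2 * concavityNumber Θ lam * D2 b y
  set P := penTheta Θ (rho • y) lam - penTheta Θ (rho • b) lam
  -- An upper bound for the surrogate's difference quotient, with the penalty already replaced by
  -- its chord P plus the curvature (1 - ε)Q.
  have hlim : Tendsto (fun ε : ℝ => (loss l₀ X (b + ε • (y - b)) - loss l₀ X b) / ε + P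
      + (1 - ε) * Q + gbf ψ (b + ε • (y - b)) b / ε) (𝓝[>] 0)
      (𝓝 (dirDeriv (loss l₀ X) b (y - b) + P + (1 - 0) * Q + 0)) := by
    have h2 : Tendsto (fun ε : ℝ => (1 - ε) * Q) (𝓝[>] 0) (𝓝 ((1 - 0) * Q)) :=
      ((tendsto_id.const_sub 1).mul_const Q).mono_left nhdsWithin_le_nhds
    exact (((hl.hasDirDeriv b (y - b)).add_const P).add h2).add (hψ.tendsto_gbf_div b (y - b))
  rw [sub_zero, one_mul, add_zero] at hlim
  refine ge_of_tendsto hlim ?_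
  filter_upwards [Ioc_mem_nhdsGT (zero_lt_one' ℝ)] with ε hε
  have h1 := hb (b + ε • (y - b))
  have h2 := hΘ.penTheta_segment_le hlam b y rho ε hε.1.le hε.2
  simp only [surrogate, gbf_self] at h1
  have h3 : 0 ≤ (loss l₀ X (b + ε • (y - b)) - loss l₀ X b) + ε * P + ε * (1 - ε) * Q
      + gbf ψ (b + ε • (y - b)) b := by linarith
  have h4 := div_nonneg h3 hε.1.le
  have hε' := hε.1.ne'
  convert h4 using 1
  field_simp

/-- The basic inequality: a fixed point obeys a bound driven by the noise only. -/
theorem IsFEstimator.basic_inequality {n p : ℕ} {l₀ : Vec n → ℝ} {X : Matrix (Fin n) (Fin p) ℝ}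
    {Θ : ℝ → ℝ → ℝ} {rho lam : ℝ} {ψ : Vec p → ℝ} {b βs : Vec p} {δ ϑ K : ℝ}
    (hb : IsFEstimator l₀ X Θ rho lam ψ b) (hΘ : IsThresholding Θ) (hlam : 0 ≤ lam)
    (hψ : DirDifferentiable ψ) (hl : DirDifferentiable (loss l₀ X))
    (hl₀ : DifferentiableAt ℝ l₀ (design X βs))
    (hreg : RegularityCondition l₀ X Θ rho lam βs δ ϑ K) :
    δ * D2 (design X b) (design X βs) + ϑ * penHard (rho • (b - βs)) lam ≤
      inner ℝ (-gradient l₀ (design X βs)) (design X (b - βs)) +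
        K * lam ^ 2 * (suppCard βs : ℝ) := by
  have h1 := hb.first_order hΘ hlam hψ hl βs
  have h2 := hreg b
  have h3 := (hasDirDeriv_loss hl₀ (b - βs)).dirDeriv_eq
  rw [inner_neg_left, ← h3]
  simp only [symGbf, gbf] at h2
  linarith

/-! ### The noise is dominated by the prediction error and the hard penalty -/

/-- The span of the columns of `X` indexed by `J`. -/
def colSpan {n p : ℕ} (X : Matrix (Fin n) (Fin p) ℝ) (J : Finset (Fin p)) : Submodule ℝ (Vec n) :=
  Submodule.span ℝ (J.image fun j => design X (EuclideanSpace.single j 1) : Finset (Vec n))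

section Columns

variable {n p : ℕ} (X : Matrix (Fin n) (Fin p) ℝ)

theorem finrank_colSpan_le (J : Finset (Fin p)) : Module.finrank ℝ (colSpan X J) ≤ J.card :=
  (finrank_span_finset_le_card _).trans Finset.card_image_le

theorem design_single_mem_colSpan {J : Finset (Fin p)} {j : Fin p} (hj : j ∈ J) :
    design X (EuclideanSpace.single j 1) ∈ colSpan X J :=
  Submodule.subset_span (Finset.mem_coe.2 (Finset.mem_image_of_mem _ hj))

theorem design_eq_sum (v : Vec p) : design X v = ∑ j, v j • design X (EuclideanSpace.single j 1) := by
  conv_lhs => rw [← (EuclideanSpace.basisFun (Fin p) ℝ).sum_repr v]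
  simp [map_sum]

theorem norm_design_single_le (j : Fin p) : ‖design X (EuclideanSpace.single j 1)‖ ≤ ‖design X‖ := by
  simpa using (design X).le_opNorm (EuclideanSpace.single j (1 : ℝ))

end Columns

theorem inner_le_norm_starProjection_mul {n : ℕ} (V : Submodule ℝ (Vec n)) (x : Vec n) {y : Vec n}
    (hy : y ∈ V) : inner ℝ x y ≤ ‖V.starProjection x‖ * ‖y‖ := by
  have h : inner ℝ (V.starProjection x) y = inner ℝ x y := by
    rw [Submodule.inner_starProjection_left_eq_right, Submodule.starProjection_eq_self_iff.2 hy]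
  rw [← h]
  exact real_inner_le_norm _ _

theorem abs_inner_le_norm_starProjection_mul {n : ℕ} (V : Submodule ℝ (Vec n)) (x : Vec n)
    {y : Vec n} (hy : y ∈ V) : |inner ℝ x y| ≤ ‖V.starProjection x‖ * ‖y‖ := by
  refine abs_le'.2 ⟨inner_le_norm_starProjection_mul V x hy, ?_⟩
  simpa using inner_le_norm_starProjection_mul V x (V.neg_mem hy)

theorem penHard₁_of_lt {t lam : ℝ} (h : |t| < lam) : penHard₁ t lam = -t ^ 2 / 2 + lam * |t| :=
  if_pos h

theorem penHard₁_of_le {t lam : ℝ} (h : lam ≤ |t|) : penHard₁ t lam = lam ^ 2 / 2 :=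
  if_neg (not_lt.2 h)

/-- Below the threshold 2P_H = 2λ|t| - t² with t² ≤ λ|t|, so P_H dominates both a linear and a
quadratic penalty. -/
theorem mul_abs_le_penHard₁ {t lam : ℝ} (h : |t| < lam) : lam * |t| ≤ 2 * penHard₁ t lam := by
  rw [penHard₁_of_lt h, ← sq_abs]
  nlinarith [abs_nonneg t]

theorem sq_le_penHard₁ {t lam : ℝ} (h : |t| < lam) : t ^ 2 ≤ 2 * penHard₁ t lam := by
  rw [penHard₁_of_lt h, ← sq_abs]
  nlinarith [abs_nonneg t]

theorem penHard₁_nonneg (t lam : ℝ) : 0 ≤ penHard₁ t lam := by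
  rcases lt_or_ge |t| lam with h | h
  · linarith [sq_le_penHard₁ h, sq_nonneg t]
  · rw [penHard₁_of_le h]; positivity

theorem penHard_nonneg {p : ℕ} (β : Vec p) (lam : ℝ) : 0 ≤ penHard β lam :=
  Finset.sum_nonneg fun _ _ => penHard₁_nonneg _ _

theorem D2_nonneg {d : ℕ} (β γ : Vec d) : 0 ≤ D2 β γ := by unfold D2; positivity

/-- If the projections of `x` on all column spaces of `X` are small, then the linear form
`⟨x, X β⟩` is controlled by the prediction error and the hard penalty. -/
theorem inner_design_le {n p : ℕ} (X : Matrix (Fin n) (Fin p) ℝ) {rho lam δ ϑ R : ℝ} (x : Vec n)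
    (hrho : ‖design X‖ ≤ rho) (hlam : 0 ≤ lam) (hδ : 0 < δ) (hϑ : 0 < ϑ)
    (hR : 64 * R ≤ min δ ϑ * ϑ * lam ^ 2)
    (hx : ∀ J : Finset (Fin p), J.Nonempty → ‖(colSpan X J).starProjection x‖ ^ 2 ≤ R * J.card)
    (β : Vec p) :
    inner ℝ x (design X β) ≤ δ / 4 * ‖design X β‖ ^ 2 + ϑ / 2 * penHard (rho • β) lam := by
  set m := min δ ϑ with hm
  have hm0 : 0 < m := lt_min hδ hϑ
  have hrho0 : 0 ≤ rho := (norm_nonneg _).trans hrho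
  set c : Fin p → Vec n := fun j => design X (EuclideanSpace.single j 1) with hc
  -- Coordinates are split at the threshold where P_H saturates.
  set J : Finset (Fin p) := Finset.univ.filter fun j => lam ≤ |rho * β j| with hJ
  set β₁ : Vec p := WithLp.toLp 2 fun j => if j ∈ J then β j else 0 with hβ₁
  set β₂ : Vec p := WithLp.toLp 2 fun j => if j ∈ J then 0 else β j with hβ₂
  have hsum : β = β₁ + β₂ := by
    ext j
    by_cases h : j ∈ J <;> simp [hβ₁, hβ₂, h]
  have hX₁ : design X β₁ = ∑ j ∈ J, β j • c j := by
    rw [design_eq_sum, ← Finset.sum_subset (Finset.subset_univ J)]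
    · exact Finset.sum_congr rfl fun j hj => by simp [hβ₁, hj, hc]
    · intro j _ hj; simp [hβ₁, hj]
  have hX₂ : design X β₂ = ∑ j ∈ Jᶜ, β j • c j := by
    rw [design_eq_sum, ← Finset.sum_subset (Finset.subset_univ Jᶜ)]
    · exact Finset.sum_congr rfl fun j hj => by simp [hβ₂, Finset.mem_compl.1 hj, hc]
    · intro j _ hj; simp [hβ₂, not_not.1 (Finset.mem_compl.not.1 hj)]
  have hlarge : ∀ j ∈ J, penHard₁ (rho * β j) lam = lam ^ 2 / 2 := fun j hj =>
    penHard₁_of_le (Finset.mem_filter.1 hj).2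
  have hsmall : ∀ j ∈ Jᶜ, |rho * β j| < lam := fun j hj => by
    simpa [hJ] using hj
  set S := ∑ j ∈ Jᶜ, penHard₁ (rho * β j) lam with hS
  have hS0 : 0 ≤ S := Finset.sum_nonneg fun _ _ => penHard₁_nonneg _ _
  have hpen : penHard (rho • β) lam = J.card * (lam ^ 2 / 2) + S := by
    rw [penHard, ← Finset.sum_add_sum_compl J, hS]
    simp only [PiLp.smul_apply, smul_eq_mul]
    rw [Finset.sum_congr rfl hlarge, Finset.sum_const, nsmul_eq_mul]
  -- the small coordinates
  have hcol : ∀ j, |inner ℝ x (c j)| ≤ ϑ * lam / 8 * rho := by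
    intro j
    have h1 := abs_inner_le_norm_starProjection_mul (colSpan X {j}) x
      (design_single_mem_colSpan X (Finset.mem_singleton_self j))
    have h2 := hx {j} (Finset.singleton_nonempty j)
    -- The singleton case of `hx`, with min(δ, ϑ) ≤ ϑ, gives a squared projection at most (ϑλ)²/64.
    have h3 : ‖(colSpan X {j}).starProjection x‖ ≤ ϑ * lam / 8 := by
      refine abs_le_of_sq_le_sq' ?_ (by positivity) |>.2
      have : m * ϑ * lam ^ 2 ≤ ϑ * ϑ * lam ^ 2 := by
        gcongr; exact min_le_right _ _
      simp only [Finset.card_singleton, Nat.cast_one, mul_one] at h2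
      nlinarith
    exact h1.trans (mul_le_mul h3 ((norm_design_single_le X j).trans hrho) (norm_nonneg _)
      (by positivity))
  have hin₂ : inner ℝ x (design X β₂) ≤ ϑ / 4 * S := by
    rw [hX₂, inner_sum, hS, Finset.mul_sum]
    refine Finset.sum_le_sum fun j hj => ?_
    rw [real_inner_smul_right]
    have h1 := mul_abs_le_penHard₁ (hsmall j hj)
    have h2 : β j * inner ℝ x (c j) ≤ |β j| * (ϑ * lam / 8 * rho) := by
      refine (le_abs_self _).trans ?_
      rw [abs_mul]
      exact mul_le_mul_of_nonneg_left (hcol j) (abs_nonneg _)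
    rw [abs_mul, abs_of_nonneg hrho0] at h1
    nlinarith
  have hnorm₂ : ‖design X β₂‖ ^ 2 ≤ 2 * S := by
    have h1 : ‖design X β₂‖ ≤ rho * ‖β₂‖ :=
      ((design X).le_opNorm β₂).trans (mul_le_mul_of_nonneg_right hrho (norm_nonneg _))
    have h2 : ‖β₂‖ ^ 2 = ∑ j ∈ Jᶜ, β j ^ 2 := by
      rw [EuclideanSpace.real_norm_sq_eq, ← Finset.sum_subset (Finset.subset_univ Jᶜ)]
      · exact Finset.sum_congr rfl fun j hj => by simp [hβ₂, Finset.mem_compl.1 hj]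
      · intro j _ hj; simp [hβ₂, not_not.1 (Finset.mem_compl.not.1 hj)]
    calc ‖design X β₂‖ ^ 2 ≤ (rho * ‖β₂‖) ^ 2 := by gcongr
      _ = ∑ j ∈ Jᶜ, (rho * β j) ^ 2 := by
        rw [mul_pow, h2, Finset.mul_sum]
        exact Finset.sum_congr rfl fun j _ => by ring
      _ ≤ ∑ j ∈ Jᶜ, 2 * penHard₁ (rho * β j) lam :=
        Finset.sum_le_sum fun j hj => sq_le_penHard₁ (hsmall j hj)
      _ = 2 * S := by rw [← Finset.mul_sum]
  -- the large coordinates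
  have hin₁ : inner ℝ x (design X β₁) ≤
      m / 16 * ‖design X β₁‖ ^ 2 + ϑ / 8 * (J.card * (lam ^ 2 / 2)) := by
    rcases J.eq_empty_or_nonempty with h | h
    · rw [hX₁, h]; simp
    have hmem : design X β₁ ∈ colSpan X J := by
      rw [hX₁]
      exact Submodule.sum_mem _ fun j hj => Submodule.smul_mem _ _ (design_single_mem_colSpan X hj)
    have h1 := inner_le_norm_starProjection_mul (colSpan X J) x hmem
    have h2 := hx J h
    set a := ‖(colSpan X J).starProjection x‖
    set y := ‖design X β₁‖
    have h3 : 64 * a ^ 2 ≤ m * ϑ * lam ^ 2 * J.card := by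
      have := mul_le_mul_of_nonneg_right hR (Nat.cast_nonneg J.card : (0 : ℝ) ≤ J.card)
      linarith
    -- Young's inequality ay ≤ my²/16 + 4a²/m; `h3` turns 4a²/m into at most ϑλ²|J|/16.
    have h4 : m * (a * y) ≤ m * (m / 16 * y ^ 2 + ϑ / 8 * (J.card * (lam ^ 2 / 2))) := by
      nlinarith [sq_nonneg (m * y / 4 - 2 * a)]
    exact h1.trans (le_of_mul_le_mul_left h4 hm0)
  -- Returning from Xβ₁ to Xβ costs ‖Xβ₂‖², which is charged to P_H. The coefficient m must thus be
  -- at most both δ and ϑ.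
  have hnorm₁ : ‖design X β₁‖ ^ 2 ≤ 2 * ‖design X β‖ ^ 2 + 2 * ‖design X β₂‖ ^ 2 := by
    have h1 : design X β₁ = design X β - design X β₂ := by
      rw [← map_sub, eq_sub_of_add_eq hsum.symm]
    have h2 : ‖design X β₁‖ ≤ ‖design X β‖ + ‖design X β₂‖ := h1 ▸ norm_sub_le _ _
    nlinarith [norm_nonneg (design X β₁), sq_nonneg (‖design X β‖ - ‖design X β₂‖)]
  have hin : inner ℝ x (design X β) = inner ℝ x (design X β₁) + inner ℝ x (design X β₂) := by
    rw [← inner_add_right, ← map_add, ← hsum]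
  rw [hin, hpen]
  have hmδ : m ≤ δ := min_le_left _ _
  have hmϑ : m ≤ ϑ := min_le_right _ _
  have e1 : m / 16 * ‖design X β₁‖ ^ 2 ≤ δ / 8 * ‖design X β‖ ^ 2 + ϑ / 4 * S := by
    have i1 : m * ‖design X β₁‖ ^ 2 ≤ m * (2 * ‖design X β‖ ^ 2 + 4 * S) :=
      mul_le_mul_of_nonneg_left (by linarith) hm0.le
    have i2 := mul_le_mul_of_nonneg_right hmδ (sq_nonneg ‖design X β‖)
    have i3 := mul_le_mul_of_nonneg_right hmϑ hS0
    linarith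
  have e2 : 0 ≤ ϑ * (J.card * (lam ^ 2 / 2)) :=
    mul_nonneg hϑ.le (mul_nonneg (Nat.cast_nonneg _) (by positivity))
  have e3 : 0 ≤ δ * ‖design X β‖ ^ 2 := by positivity
  linarith

/-! ### Moment generating functions of sub-Gaussian variables -/

section SubGaussian

variable {Ω : Type*} [MeasurableSpace Ω] {μ : Measure Ω} {ξ : Ω → ℝ}

/-- Layer-cake integration at half the tail rate: the tail exp(-2t) beats the weight exp(t). -/
theorem IsSubGaussian.exists_lintegral_exp_sq_lt_top [IsProbabilityMeasure μ]
    (h : IsSubGaussian μ ξ) (hξ : AEMeasurable ξ μ) :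
    ∃ a > (0 : ℝ), ∫⁻ ω, ENNReal.ofReal (Real.exp (a * ξ ω ^ 2)) ∂μ < ⊤ := by
  obtain ⟨C, hC, c, hc, htail⟩ := h
  refine ⟨c / 2, by positivity, ?_⟩
  have hcake := lintegral_comp_eq_lintegral_meas_le_mul μ (f := fun ω => c / 2 * ξ ω ^ 2)
    (g := Real.exp) (Eventually.of_forall fun ω => by positivity) (by fun_prop)
    (fun t _ => Real.continuous_exp.intervalIntegrable _ _)
    (Eventually.of_forall fun t => (Real.exp_pos t).le)
  simp only [integral_exp, Real.exp_zero] at hcake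
  have hle : ∫⁻ ω, ENNReal.ofReal (Real.exp (c / 2 * ξ ω ^ 2)) ∂μ ≤
      ∫⁻ ω, (ENNReal.ofReal (Real.exp (c / 2 * ξ ω ^ 2) - 1) + 1) ∂μ := by
    refine lintegral_mono fun ω => ?_
    conv_lhs => rw [← sub_add_cancel (Real.exp (c / 2 * ξ ω ^ 2)) 1]
    exact ENNReal.ofReal_add_le.trans (by simp)
  refine hle.trans_lt ?_
  rw [lintegral_add_right _ measurable_const, hcake]
  refine ENNReal.add_lt_top.2 ⟨?_, by simp⟩
  have hbound : ∫⁻ t in Set.Ioi (0 : ℝ), μ {a | t ≤ c / 2 * ξ a ^ 2} * ENNReal.ofReal (Real.exp t) ≤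
      ∫⁻ t in Set.Ioi (0 : ℝ), ENNReal.ofReal (C * Real.exp (-t)) := by
    refine setLIntegral_mono (by fun_prop) fun t ht => ?_
    have ht' : 0 < t := ht
    have hsub : {a | t ≤ c / 2 * ξ a ^ 2} ⊆ {a | √(2 * t / c) ≤ |ξ a|} := fun a ha => by
      have ha' : t ≤ c / 2 * ξ a ^ 2 := ha
      refine Real.sqrt_le_iff.2 ⟨abs_nonneg _, ?_⟩
      rw [sq_abs, div_le_iff₀ hc]
      linarith
    refine (mul_le_mul_left ((measure_mono hsub).trans
      (htail _ (Real.sqrt_pos.2 (by positivity)))) _).trans ?_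
    rw [← ENNReal.ofReal_mul (by positivity), Real.sq_sqrt (by positivity), mul_assoc,
      ← Real.exp_add]
    refine ENNReal.ofReal_le_ofReal (le_of_eq ?_)
    congr 2
    field_simp
    ring
  refine hbound.trans_lt ?_
  have hint : IntegrableOn (fun t : ℝ => C * Real.exp (-t)) (Set.Ioi 0) :=
    (integrableOn_exp_neg_Ioi 0).const_mul C
  exact hint.lintegral_lt_top

/-- Dominated convergence as s → ∞ sends the exponential moment to 1 < 2. Nonemptiness matters
because `sInf ∅ = 0` in ℝ would make a bound on `psi2Norm` meaningless. -/
theorem IsSubGaussian.nonempty_psi2 [IsProbabilityMeasure μ] (h : IsSubGaussian μ ξ)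
    (hξ : AEMeasurable ξ μ) :
    {s : ℝ | 0 < s ∧ ∫⁻ ω, ENNReal.ofReal (Real.exp (ξ ω ^ 2 / s ^ 2)) ∂μ ≤ 2}.Nonempty := by
  obtain ⟨a, ha, hfin⟩ := h.exists_lintegral_exp_sq_lt_top hξ
  have hinv : Tendsto (fun s : ℝ => (s ^ 2)⁻¹) atTop (𝓝 0) :=
    (tendsto_pow_atTop two_ne_zero).inv_tendsto_atTop
  have hlim : Tendsto (fun s : ℝ => ∫⁻ ω, ENNReal.ofReal (Real.exp (ξ ω ^ 2 / s ^ 2)) ∂μ) atTop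
      (𝓝 (∫⁻ _, 1 ∂μ)) := by
    refine tendsto_lintegral_filter_of_dominated_convergence' _
      (Eventually.of_forall fun s => by fun_prop) ?_ hfin.ne ?_
    · filter_upwards [hinv.eventually_lt_const ha] with s hs
      refine Eventually.of_forall fun ω => ENNReal.ofReal_le_ofReal (Real.exp_le_exp.2 ?_)
      rw [div_eq_inv_mul]
      exact mul_le_mul_of_nonneg_right hs.le (sq_nonneg _)
    · refine Eventually.of_forall fun ω => ?_
      have h1 : Tendsto (fun s : ℝ => ξ ω ^ 2 / s ^ 2) atTop (𝓝 0) := by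
        simpa [div_eq_mul_inv] using hinv.const_mul (ξ ω ^ 2)
      simpa using ENNReal.tendsto_ofReal ((Real.continuous_exp.tendsto 0).comp h1)
  rw [lintegral_one, measure_univ] at hlim
  obtain ⟨s, hs, hs'⟩ := ((hlim.eventually_lt_const ENNReal.one_lt_two).and
    (eventually_gt_atTop 0)).exists
  exact ⟨s, hs', hs.le⟩

theorem IsSubGaussian.lintegral_exp_sq_le [IsProbabilityMeasure μ] (h : IsSubGaussian μ ξ)
    (hξ : AEMeasurable ξ μ) {s : ℝ} (hs : psi2Norm μ ξ < s) :
    ∫⁻ ω, ENNReal.ofReal (Real.exp (ξ ω ^ 2 / s ^ 2)) ∂μ ≤ 2 := by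
  obtain ⟨r, ⟨hr0, hr⟩, hrs⟩ := (csInf_lt_iff ⟨0, fun _ hx => hx.1.le⟩ (h.nonempty_psi2 hξ)).1 hs
  refine le_trans (lintegral_mono fun ω => ?_) hr
  refine ENNReal.ofReal_le_ofReal (Real.exp_le_exp.2 ?_)
  gcongr

/-- Use ξ ≤ ξ²/s² + s²/4 for s > τ, then let s ↓ τ; the limit also covers τ = 0. -/
theorem IsSubGaussian.lintegral_exp_le [IsProbabilityMeasure μ] (h : IsSubGaussian μ ξ)
    (hξ : AEMeasurable ξ μ) {τ : ℝ} (hτ0 : 0 ≤ τ) (hτ : psi2Norm μ ξ ≤ τ) :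
    ∫⁻ ω, ENNReal.ofReal (Real.exp (ξ ω)) ∂μ ≤ ENNReal.ofReal (2 * Real.exp (τ ^ 2 / 4)) := by
  have hcont : Continuous fun s : ℝ => ENNReal.ofReal (2 * Real.exp (s ^ 2 / 4)) :=
    ENNReal.continuous_ofReal.comp (by fun_prop)
  refine ge_of_tendsto ((hcont.tendsto τ).mono_left (nhdsWithin_le_nhds (s := Set.Ioi τ))) ?_
  filter_upwards [self_mem_nhdsWithin] with s hs
  have hs' : τ < s := hs
  have hs0 : 0 < s := hτ0.trans_lt hs'
  calc ∫⁻ ω, ENNReal.ofReal (Real.exp (ξ ω)) ∂μ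
      ≤ ∫⁻ ω, ENNReal.ofReal (Real.exp (s ^ 2 / 4)) *
          ENNReal.ofReal (Real.exp (ξ ω ^ 2 / s ^ 2)) ∂μ := by
        refine lintegral_mono fun ω => ?_
        rw [← ENNReal.ofReal_mul (Real.exp_pos _).le, ← Real.exp_add]
        refine ENNReal.ofReal_le_ofReal (Real.exp_le_exp.2 ?_)
        have h1 : ξ ω = ξ ω / s * s := by field_simp
        have h2 := sq_nonneg (ξ ω / s - s / 2)
        rw [← div_pow]
        linarith
    _ = ENNReal.ofReal (Real.exp (s ^ 2 / 4)) *
          ∫⁻ ω, ENNReal.ofReal (Real.exp (ξ ω ^ 2 / s ^ 2)) ∂μ :=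
        lintegral_const_mul'' _ (by fun_prop)
    _ ≤ ENNReal.ofReal (Real.exp (s ^ 2 / 4)) * 2 := by
        gcongr; exact h.lintegral_exp_sq_le hξ (hτ.trans_lt hs')
    _ = ENNReal.ofReal (2 * Real.exp (s ^ 2 / 4)) := by
        rw [mul_comm, ENNReal.ofReal_mul zero_le_two]; simp

end SubGaussian

/-! ### Projections of a sub-Gaussian vector -/

section Gaussian

variable {W : Type*} [NormedAddCommGroup W] [InnerProductSpace ℝ W] [FiniteDimensional ℝ W]
  [MeasurableSpace W] [BorelSpace W]

theorem lintegral_exp_neg_mul_sq_add_inner {b : ℝ} (hb : 0 < b) (w : W) :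
    ∫⁻ v : W, ENNReal.ofReal (Real.exp (-b * ‖v‖ ^ 2 + inner ℝ w v)) =
      ENNReal.ofReal ((Real.pi / b) ^ (Module.finrank ℝ W / 2 : ℝ) *
        Real.exp (‖w‖ ^ 2 / (4 * b))) := by
  have hb' : 0 < (b : ℂ).re := hb
  have hcast : (fun v : W => Complex.exp (-(b : ℂ) * ‖v‖ ^ 2 + 1 * (inner ℝ w v : ℝ))) =
      fun v : W => ((Real.exp (-b * ‖v‖ ^ 2 + inner ℝ w v) : ℝ) : ℂ) := by
    ext v; push_cast; ring_nf
  have hint := GaussianFourier.integrable_cexp_neg_mul_sq_norm_add hb' 1 w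
  have hval := GaussianFourier.integral_cexp_neg_mul_sq_norm_add hb' 1 w
  rw [hcast] at hint hval
  have hint' : Integrable fun v : W => Real.exp (-b * ‖v‖ ^ 2 + inner ℝ w v) :=
    hint.re.congr (Eventually.of_forall fun v => Complex.ofReal_re _)
  rw [← ofReal_integral_eq_lintegral_ofReal hint' (Eventually.of_forall fun v => (Real.exp_pos _).le)]
  congr 1
  rw [integral_complex_ofReal] at hval
  apply Complex.ofReal_injective
  rw [hval]
  push_cast
  rw [Complex.ofReal_cpow (by positivity)]
  push_cast
  simp

end Gaussian

section Projection

variable {Ω : Type*} [MeasurableSpace Ω] {μ : Measure Ω} [IsProbabilityMeasure μ] {n : ℕ}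
  {ξ : Ω → Vec n} {σ : ℝ}

/-- Linearization: up to a constant, exp(‖P_V x‖²/(2s²)) is the integral over v ∈ V of exp(⟨x, v⟩ -
s²‖v‖²/2). After Tonelli, the scalar bound uses up half of the Gaussian exponent, and the ratio of
the two Gaussian integrals is 2^(dim V/2). -/
theorem IsSubGaussianVec.lintegral_exp_norm_starProjection_sq_le (h : IsSubGaussianVec μ ξ σ)
    (hσ : 0 ≤ σ) (V : Submodule ℝ (Vec n)) {s : ℝ} (hs : σ < s) :
    ∫⁻ ω, ENNReal.ofReal (Real.exp (‖V.starProjection (ξ ω)‖ ^ 2 / (2 * s ^ 2))) ∂μ ≤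
      ENNReal.ofReal (2 * 2 ^ Module.finrank ℝ V) := by
  have hs0 : 0 < s := hσ.trans_lt hs
  set b : ℝ := s ^ 2 / 2 with hb
  have hb0 : 0 < b := by positivity
  set k : ℝ := (Module.finrank ℝ V : ℝ) / 2 with hk
  have hpi : 0 < (Real.pi / b) ^ k := by positivity
  have hinner : ∀ x (v : V), inner ℝ (V.orthogonalProjectionOnto x) v = inner ℝ x (v : Vec n) := by
    intro x v
    simp
  have hswap : ∫⁻ ω, (∫⁻ v : V, ENNReal.ofReal
        (Real.exp (-b * ‖v‖ ^ 2 + inner ℝ (ξ ω) (v : Vec n)))) ∂μ =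
      ∫⁻ v : V, ∫⁻ ω, ENNReal.ofReal
        (Real.exp (-b * ‖v‖ ^ 2 + inner ℝ (ξ ω) (v : Vec n))) ∂μ := by
    refine lintegral_lintegral_swap ?_
    have h1 : AEMeasurable (fun z : Ω × V => ξ z.1) (μ.prod volume) := h.1.comp_fst
    have h2 : AEMeasurable (fun z : Ω × V => (z.2 : Vec n)) (μ.prod volume) :=
      (measurable_subtype_coe.comp measurable_snd).aemeasurable
    have h3 := h1.inner (𝕜 := ℝ) h2
    have h4 : AEMeasurable (fun z : Ω × V => -b * ‖z.2‖ ^ 2) (μ.prod volume) := by fun_prop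
    exact (Real.measurable_exp.comp_aemeasurable (h4.add h3)).ennreal_ofReal
  have hin : ∀ v : V, ∫⁻ ω, ENNReal.ofReal
        (Real.exp (-b * ‖v‖ ^ 2 + inner ℝ (ξ ω) (v : Vec n))) ∂μ ≤
      ENNReal.ofReal 2 * ENNReal.ofReal (Real.exp (-(s ^ 2 / 4) * ‖v‖ ^ 2 + inner ℝ (0 : V) v)) := by
    intro v
    have hsub := (h.2 (v : Vec n))
    have hmeas : AEMeasurable (fun ω => inner ℝ (ξ ω) (v : Vec n)) μ :=
      h.1.inner aemeasurable_const
    have hmgf := hsub.1.lintegral_exp_le hmeas (by positivity) hsub.2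
    calc _ = ∫⁻ ω, ENNReal.ofReal (Real.exp (-b * ‖v‖ ^ 2)) *
            ENNReal.ofReal (Real.exp (inner ℝ (ξ ω) (v : Vec n))) ∂μ := by
          refine lintegral_congr fun ω => ?_
          rw [← ENNReal.ofReal_mul (Real.exp_pos _).le, ← Real.exp_add]
      _ = ENNReal.ofReal (Real.exp (-b * ‖v‖ ^ 2)) *
            ∫⁻ ω, ENNReal.ofReal (Real.exp (inner ℝ (ξ ω) (v : Vec n))) ∂μ :=
          lintegral_const_mul'' _ (by fun_prop)
      _ ≤ ENNReal.ofReal (Real.exp (-b * ‖v‖ ^ 2)) *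
            ENNReal.ofReal (2 * Real.exp ((σ * ‖(v : Vec n)‖) ^ 2 / 4)) := by gcongr
      _ ≤ _ := by
          rw [← ENNReal.ofReal_mul (Real.exp_pos _).le, ← ENNReal.ofReal_mul zero_le_two]
          refine ENNReal.ofReal_le_ofReal ?_
          rw [mul_left_comm, ← Real.exp_add]
          refine mul_le_mul_of_nonneg_left (Real.exp_le_exp.2 ?_) zero_le_two
          have : σ ^ 2 * ‖v‖ ^ 2 ≤ s ^ 2 * ‖v‖ ^ 2 := by gcongr
          simp only [hb, Submodule.coe_norm, inner_zero_left, mul_pow] at this ⊢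
          linarith
  have hmain : ENNReal.ofReal ((Real.pi / b) ^ k) *
        ∫⁻ ω, ENNReal.ofReal (Real.exp (‖V.starProjection (ξ ω)‖ ^ 2 / (2 * s ^ 2))) ∂μ ≤
      ENNReal.ofReal ((Real.pi / b) ^ k) * ENNReal.ofReal (2 * 2 ^ k) := by
    calc _ = ∫⁻ ω, (∫⁻ v : V, ENNReal.ofReal
          (Real.exp (-b * ‖v‖ ^ 2 + inner ℝ (ξ ω) (v : Vec n)))) ∂μ := by
          rw [← lintegral_const_mul' _ _ ENNReal.ofReal_ne_top]
          refine lintegral_congr fun ω => ?_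
          simp only [← hinner]
          rw [lintegral_exp_neg_mul_sq_add_inner hb0, ← ENNReal.ofReal_mul hpi.le,
            Submodule.starProjection_apply, Submodule.coe_norm, hb]
          congr 4
          ring
      _ ≤ ∫⁻ v : V, ENNReal.ofReal 2 * ENNReal.ofReal
            (Real.exp (-(s ^ 2 / 4) * ‖v‖ ^ 2 + inner ℝ (0 : V) v)) := by
          rw [hswap]; exact lintegral_mono hin
      _ = _ := by
          rw [lintegral_const_mul' _ _ ENNReal.ofReal_ne_top,
            lintegral_exp_neg_mul_sq_add_inner (by positivity), ← ENNReal.ofReal_mul zero_le_two,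
            ← ENNReal.ofReal_mul hpi.le]
          congr 1
          rw [show Real.pi / (s ^ 2 / 4) = Real.pi / b * 2 by rw [hb]; field_simp; norm_num,
            Real.mul_rpow (by positivity) zero_le_two]
          simp
          ring
  refine ((ENNReal.mul_le_mul_iff_right (ENNReal.ofReal_pos.2 hpi).ne'
    ENNReal.ofReal_ne_top).1 hmain).trans (ENNReal.ofReal_le_ofReal ?_)
  rw [← Real.rpow_natCast]
  gcongr
  · norm_num
  · rw [hk]; linarith [(Nat.cast_nonneg (Module.finrank ℝ V) : (0 : ℝ) ≤ _)]

/-- Markov's inequality at each s > σ; the events increase as s ↓ σ, and their union contains the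
strict event. The limit handles σ = 0. -/
theorem IsSubGaussianVec.measure_norm_starProjection_sq_gt_le (h : IsSubGaussianVec μ ξ σ)
    (hσ : 0 ≤ σ) (V : Submodule ℝ (Vec n)) {q : ℝ} (hq : 0 ≤ q) :
    μ {ω | 2 * σ ^ 2 * q < ‖V.starProjection (ξ ω)‖ ^ 2} ≤
      ENNReal.ofReal (2 * 2 ^ Module.finrank ℝ V * Real.exp (-q)) := by
  have hbound : ∀ s, σ < s → μ {ω | 2 * s ^ 2 * q ≤ ‖V.starProjection (ξ ω)‖ ^ 2} ≤
      ENNReal.ofReal (2 * 2 ^ Module.finrank ℝ V * Real.exp (-q)) := by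
    intro s hs
    have hs0 : 0 < s := hσ.trans_lt hs
    have hmeas : AEMeasurable (fun ω => ENNReal.ofReal
        (Real.exp (‖V.starProjection (ξ ω)‖ ^ 2 / (2 * s ^ 2)))) μ := by
      have h1 : AEMeasurable (fun ω => V.starProjection (ξ ω)) μ :=
        V.starProjection.measurable.comp_aemeasurable h.1
      fun_prop
    have h2 := mul_meas_ge_le_lintegral₀ hmeas (ENNReal.ofReal (Real.exp q))
    have h3 := h2.trans (h.lintegral_exp_norm_starProjection_sq_le hσ V hs)
    have hset : {ω | 2 * s ^ 2 * q ≤ ‖V.starProjection (ξ ω)‖ ^ 2} ⊆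
        {ω | ENNReal.ofReal (Real.exp q) ≤ ENNReal.ofReal
          (Real.exp (‖V.starProjection (ξ ω)‖ ^ 2 / (2 * s ^ 2)))} := by
      intro ω hω
      refine ENNReal.ofReal_le_ofReal (Real.exp_le_exp.2 ?_)
      rw [le_div_iff₀ (by positivity), mul_comm]
      exact hω
    refine (measure_mono hset).trans ?_
    rw [Real.exp_neg, ← div_eq_mul_inv, ENNReal.ofReal_div_of_pos (Real.exp_pos _),
      ENNReal.le_div_iff_mul_le (Or.inl (by simp [Real.exp_pos])) (Or.inl ENNReal.ofReal_ne_top),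
      mul_comm]
    exact h3
  set u : ℕ → ℝ := fun m => σ + 1 / ((m : ℝ) + 1) with hu
  have hulim : Tendsto (fun m => 2 * u m ^ 2 * q) atTop (𝓝 (2 * σ ^ 2 * q)) := by
    have h1 : Tendsto u atTop (𝓝 (σ + 0)) := tendsto_one_div_add_atTop_nhds_zero_nat.const_add σ
    rw [add_zero] at h1
    exact ((h1.pow 2).const_mul 2).mul_const q
  have hsub : {ω | 2 * σ ^ 2 * q < ‖V.starProjection (ξ ω)‖ ^ 2} ⊆
      ⋃ m, {ω | 2 * u m ^ 2 * q ≤ ‖V.starProjection (ξ ω)‖ ^ 2} := by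
    intro ω hω
    obtain ⟨m, hm⟩ := (hulim.eventually_lt_const hω).exists
    exact Set.mem_iUnion.2 ⟨m, hm.le⟩
  have hmono : Monotone fun m => {ω | 2 * u m ^ 2 * q ≤ ‖V.starProjection (ξ ω)‖ ^ 2} := by
    intro i j hij ω hω
    have hω' : 2 * u i ^ 2 * q ≤ ‖V.starProjection (ξ ω)‖ ^ 2 := hω
    refine le_trans ?_ hω'
    have hj : 0 ≤ u j := by simp only [hu]; positivity
    have hij' : u j ≤ u i := by
      simp only [hu]
      gcongr
    gcongr
  refine (measure_mono hsub).trans ?_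
  rw [hmono.measure_iUnion]
  refine iSup_le fun m => hbound _ ?_
  simp only [hu]
  have : (0 : ℝ) < 1 / ((m : ℝ) + 1) := by positivity
  linarith

end Projection

/-- With overwhelming probability the projections of a sub-Gaussian vector on all column spaces
`colSpan X J` are simultaneously small. -/
theorem IsSubGaussianVec.measure_exists_colSpan_gt_le {Ω : Type*} [MeasurableSpace Ω]
    {μ : Measure Ω} [IsProbabilityMeasure μ] {n p : ℕ} {ξ : Ω → Vec n} {σ : ℝ}
    (h : IsSubGaussianVec μ ξ σ) (hσ : 0 ≤ σ) (hp : 0 < p) (X : Matrix (Fin n) (Fin p) ℝ)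
    {a : ℝ} (ha : 2 ≤ a) :
    μ {ω | ∃ J : Finset (Fin p), J.Nonempty ∧
        2 * σ ^ 2 * (a * Real.log (Real.exp 1 * p)) * J.card <
          ‖(colSpan X J).starProjection (ξ ω)‖ ^ 2} ≤
      ENNReal.ofReal (2 * (p : ℝ) ^ (-(a / 2))) := by
  have hp1 : (1 : ℝ) ≤ p := by exact_mod_cast hp
  have hp0 : (0 : ℝ) < p := by linarith
  have hlogp : 0 ≤ Real.log p := Real.log_nonneg hp1
  have hlog : Real.log (Real.exp 1 * p) = 1 + Real.log p := by
    rw [Real.log_mul (Real.exp_pos 1).ne' hp0.ne', Real.log_exp]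
  rw [hlog]
  set y : ℝ := 2 * Real.exp (-(a * (1 + Real.log p))) with hy
  have hy0 : 0 < y := by positivity
  set T : Finset (Finset (Fin p)) := Finset.univ.erase ∅ with hT
  have hset : {ω | ∃ J : Finset (Fin p), J.Nonempty ∧
        2 * σ ^ 2 * (a * (1 + Real.log p)) * J.card <
          ‖(colSpan X J).starProjection (ξ ω)‖ ^ 2} ⊆
      ⋃ J ∈ T, {ω | 2 * σ ^ 2 * (a * (1 + Real.log p) * J.card) <
          ‖(colSpan X J).starProjection (ξ ω)‖ ^ 2} := by
    rintro ω ⟨J, hJ, hω⟩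
    refine Set.mem_biUnion (x := J) (Finset.mem_coe.2 (by simp [hT, hJ.ne_empty])) ?_
    simpa only [Set.mem_ofPred_eq, mul_assoc] using hω
  have hone : ∀ J ∈ T, μ {ω | 2 * σ ^ 2 * (a * (1 + Real.log p) * J.card) <
          ‖(colSpan X J).starProjection (ξ ω)‖ ^ 2} ≤ ENNReal.ofReal (2 * y ^ J.card) := by
    intro J _
    refine (h.measure_norm_starProjection_sq_gt_le hσ _ (by positivity)).trans
      (ENNReal.ofReal_le_ofReal ?_)
    rw [hy, mul_pow, ← Real.exp_nat_mul, ← mul_assoc]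
    have := finrank_colSpan_le X J
    gcongr
    · norm_num
    · linarith
  -- The binomial theorem sums over all subsets at once; the empty set accounts for the -1.
  have hsum : ∑ J ∈ T, 2 * y ^ J.card = 2 * ((1 + y) ^ p - 1) := by
    have h1 := Fintype.sum_pow_mul_eq_add_pow (Fin p) y 1
    rw [← Finset.add_sum_erase _ _ (Finset.mem_univ ∅)] at h1
    simp only [one_pow, mul_one, Finset.card_empty, pow_zero, Fintype.card_fin] at h1
    rw [← Finset.mul_sum, add_comm 1 y, ← h1]
    ring
  have hpy : p * y ≤ 2 * Real.exp (-2) * (p : ℝ) ^ (-(a / 2)) := by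
    rw [Real.rpow_def_of_pos hp0, hy, mul_assoc 2, ← Real.exp_add]
    nth_rewrite 1 [← Real.exp_log hp0]
    rw [mul_left_comm, ← Real.exp_add]
    refine mul_le_mul_of_nonneg_left (Real.exp_le_exp.2 ?_) zero_le_two
    nlinarith [mul_nonneg (sub_nonneg.2 ha) hlogp]
  have hexp2 : Real.exp (-2) ≤ 1 / 4 := by
    rw [Real.exp_neg, ← one_div]
    have : (4 : ℝ) ≤ Real.exp 2 := by
      have h1 := Real.add_one_le_exp (1 : ℝ)
      have h2 : Real.exp 2 = Real.exp 1 * Real.exp 1 := by rw [← Real.exp_add]; norm_num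
      nlinarith
    gcongr
  have hpow1 : (p : ℝ) ^ (-(a / 2)) ≤ 1 := Real.rpow_le_one_of_one_le_of_nonpos hp1 (by linarith)
  have hpow0 : 0 < (p : ℝ) ^ (-(a / 2)) := by positivity
  have hpy' : p * y ≤ 1 / 2 * (p : ℝ) ^ (-(a / 2)) := hpy.trans (by nlinarith)
  -- With z = py ≤ 1/2, (1 + y)^p ≤ e^z ≤ 1/(1 - z) ≤ 1 + 2z.
  have hbin : (1 + y) ^ p - 1 ≤ 2 * (p * y) := by
    have h1 : (1 + y) ^ p ≤ Real.exp (p * y) := by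
      rw [Real.exp_nat_mul]
      gcongr
      linarith [Real.add_one_le_exp y]
    have hz0 : 0 ≤ p * y := by positivity
    have h2 : Real.exp (p * y) * (1 - p * y) ≤ 1 := by
      have h3 := Real.add_one_le_exp (-(p * y))
      calc Real.exp (p * y) * (1 - p * y) ≤ Real.exp (p * y) * Real.exp (-(p * y)) := by
            gcongr; linarith
        _ = 1 := by rw [← Real.exp_add]; simp
    nlinarith
  calc _ ≤ ∑ J ∈ T, ENNReal.ofReal (2 * y ^ J.card) :=
        (measure_mono hset).trans ((measure_biUnion_finset_le _ _).trans (Finset.sum_le_sum hone))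
    _ = ENNReal.ofReal (2 * ((1 + y) ^ p - 1)) := by
        rw [← ENNReal.ofReal_sum_of_nonneg fun _ _ => by positivity, hsum]
    _ ≤ _ := ENNReal.ofReal_le_ofReal (by linarith)

end Breg

/-! ### The oracle inequality on the good event -/

theorem theorem4 :
    ∃ A₀ > (0 : ℝ), ∃ C > (0 : ℝ), ∃ c > (0 : ℝ),
      ∀ (Ω : Type*) [MeasurableSpace Ω] (μ : Measure Ω) [IsProbabilityMeasure μ]
        (n p : ℕ) (_hp : 0 < p)
        (X : Matrix (Fin n) (Fin p) ℝ) (l₀ : Ω → Vec n → ℝ) (βs : Vec p)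
        (Θ : ℝ → ℝ → ℝ) (_hΘ : IsThresholding Θ)
        (rho : ℝ) (_hrho : ‖design X‖ ≤ rho)
        (σ : ℝ) (_hσ : 0 ≤ σ)
        -- the random loss is directionally differentiable in β, and differentiable at the truth
        (_hl : ∀ᵐ ω ∂μ, DirDifferentiable (loss (l₀ ω) X))
        (_hl₀ : ∀ᵐ ω ∂μ, DifferentiableAt ℝ (l₀ ω) (design X βs))
        -- the effective noise is sub-Gaussian with mean zero and scale bounded by σ
        (_hε : IsSubGaussianVec μ (effectiveNoise l₀ X βs) σ)
        (_hε₀ : ∫ ω, effectiveNoise l₀ X βs ω ∂μ = 0)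
        (A : ℝ) (_hA : A₀ ≤ A)
        (δ ϑ K lam : ℝ) (_hδ : 0 < δ) (_hϑ : 0 < ϑ) (_hK : 0 ≤ K)
        (_hlam : lam = A * σ * √(Real.log (Real.exp 1 * p)) / √(min δ ϑ * ϑ))
        (_hreg : ∀ᵐ ω ∂μ, RegularityCondition (l₀ ω) X Θ rho lam βs δ ϑ K),
        ∃ E : Set Ω, MeasurableSet E ∧ 1 - C * (p : ℝ) ^ (-c * A ^ 2) ≤ μ.real E ∧
          ∀ ω ∈ E, ∀ ψ : Vec p → ℝ, DirDifferentiable ψ →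
            ∀ b : Vec p, IsFEstimator (l₀ ω) X Θ rho lam ψ b →
              D2 (design X b) (design X βs)
                  ≤ 2 * K * A ^ 2 / (min δ ϑ * δ * ϑ)
                      * σ ^ 2 * (suppCard βs : ℝ) * Real.log (Real.exp 1 * p) ∧
              penHard (rho • (b - βs)) lam
                  ≤ 4 * K * A ^ 2 / (min δ ϑ * ϑ ^ 2)
                      * σ ^ 2 * (suppCard βs : ℝ) * Real.log (Real.exp 1 * p) := by
  -- The union bound is applied with a = A²/128, chosen so that R = 2σ²a log(ep) satisfies 64R =
  -- (δ∧ϑ)ϑλ². Then a ≥ 2 forces A ≥ 16, and the exponent a/2 gives 1/256.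
  refine ⟨16, by norm_num, 2, by norm_num, 1 / 256, by norm_num, ?_⟩
  intro Ω _ μ _ n p hp X l₀ βs Θ hΘ rho hrho σ hσ hl hl₀ hε _ A hA δ ϑ K lam hδ hϑ hK hlam hreg
  have hm : 0 < min δ ϑ := lt_min hδ hϑ
  set L := Real.log (Real.exp 1 * p)
  have hL0 : 0 ≤ L := by
    have hp1 : (1 : ℝ) ≤ p := by exact_mod_cast hp
    exact Real.log_nonneg (by nlinarith [Real.add_one_le_exp (1 : ℝ)])
  have hlam0 : 0 ≤ lam := by rw [hlam]; positivity
  have hlam2 : lam ^ 2 = A ^ 2 * σ ^ 2 * L / (min δ ϑ * ϑ) := by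
    rw [hlam, div_pow, mul_pow, mul_pow, Real.sq_sqrt hL0, Real.sq_sqrt (by positivity)]
  set bad : Set Ω := {ω | ∃ J : Finset (Fin p), J.Nonempty ∧
    2 * σ ^ 2 * (A ^ 2 / 128 * L) * J.card <
      ‖(colSpan X J).starProjection (effectiveNoise l₀ X βs ω)‖ ^ 2}
  have hbadμ : μ bad ≤ ENNReal.ofReal (2 * (p : ℝ) ^ (-(A ^ 2 / 128 / 2))) :=
    hε.measure_exists_colSpan_gt_le hσ hp X (by nlinarith)
  set good : Set Ω := {ω | DirDifferentiable (loss (l₀ ω) X) ∧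
    DifferentiableAt ℝ (l₀ ω) (design X βs) ∧ RegularityCondition (l₀ ω) X Θ rho lam βs δ ϑ K}
  have hgood : μ goodᶜ = 0 := by
    have : ∀ᵐ ω ∂μ, ω ∈ good := by
      filter_upwards [hl, hl₀, hreg] with ω h1 h2 h3 using ⟨h1, h2, h3⟩
    exact this
  have hunion : μ.real (bad ∪ goodᶜ) ≤ 2 * (p : ℝ) ^ (-(1 / 256) * A ^ 2) := by
    refine ENNReal.toReal_le_of_le_ofReal (by positivity) ?_
    refine (measure_union_le _ _).trans ?_
    rwa [hgood, add_zero, show -(1 / 256) * A ^ 2 = -(A ^ 2 / 128 / 2) by ring]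
  -- The exceptional set need not be measurable, so it is enlarged to a measurable set of equal
  -- measure.
  refine ⟨(toMeasurable μ (bad ∪ goodᶜ))ᶜ, (measurableSet_toMeasurable _ _).compl, ?_, ?_⟩
  · rw [probReal_compl_eq_one_sub (measurableSet_toMeasurable _ _), measureReal_def,
      measure_toMeasurable, ← measureReal_def]
    linarith
  intro ω hω ψ hψ b hb
  have hω' : ω ∉ bad ∪ goodᶜ := fun h => hω (subset_toMeasurable _ _ h)
  rw [Set.mem_union, not_or, Set.notMem_compl_iff] at hω'
  obtain ⟨hωbad, hd, hd₀, hr⟩ := hω'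
  have hbasic := hb.basic_inequality hΘ hlam0 hψ hd hd₀ hr
  have hnoise := inner_design_le X (effectiveNoise l₀ X βs ω) hrho hlam0 hδ hϑ
    (R := 2 * σ ^ 2 * (A ^ 2 / 128 * L))
    (by rw [hlam2]; field_simp; linarith)
    (fun J hJ => not_lt.1 fun h => hωbad ⟨J, hJ, h⟩) (b - βs)
  have hD : ‖design X (b - βs)‖ ^ 2 = 2 * D2 (design X b) (design X βs) := by
    rw [D2, map_sub]; ring
  rw [hD] at hnoise
  simp only [effectiveNoise] at hnoise
  have hP0 := penHard_nonneg (rho • (b - βs)) lam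
  have hD0 := D2_nonneg (design X b) (design X βs)
  -- The noise is at most (δD₂ + ϑP_H)/2, hence the factor 2 after absorption.
  have hmain : δ * D2 (design X b) (design X βs) + ϑ * penHard (rho • (b - βs)) lam ≤
      2 * (K * lam ^ 2 * (suppCard βs : ℝ)) := by linarith
  have hδD : 0 ≤ δ * D2 (design X b) (design X βs) := by positivity
  have hϑP : 0 ≤ ϑ * penHard (rho • (b - βs)) lam := by positivity
  have hQ : 0 ≤ K * lam ^ 2 * (suppCard βs : ℝ) := by positivity
  constructor
  · have h1 : D2 (design X b) (design X βs) ≤ 2 * (K * lam ^ 2 * (suppCard βs : ℝ)) / δ := by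
      rw [le_div_iff₀ hδ]; linarith
    refine h1.trans (le_of_eq ?_)
    rw [hlam2]
    field_simp
  · have h1 : penHard (rho • (b - βs)) lam ≤ 4 * (K * lam ^ 2 * (suppCard βs : ℝ)) / ϑ := by
      rw [le_div_iff₀ hϑ]; linarith
    refine h1.trans (le_of_eq ?_)
    rw [hlam2]
    field_simp
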